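/- Let $G$ be a finite connected simple graph without bridges, drawn in the plane without crossings: its vertices are distinct points, each edge is a Jordan arc joining its two ends and passing through no other vertex, and two distinct edges meet at most in common ends. The faces of $G$ are the connected components of the complement of the drawing; the finite faces are the bounded ones. The edges of a face are the edges of $G$ contained in its boundary. The signature of a cycle $C$ in $G$ is the function which assigns to each finite face of $G$ the number of edges of that face which belong to $C$. If $C_1$ and $C_2$ are two cycles in $G$ with the same signature, then the number of edges of $G$ which belong to exactly one of $C_1$ and $C_2$ is divisible by $4$. -/

import Mathlib

/-- A drawing of the graph `G` in the plane `ℂ` without crossings: the vertices are distinct points,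
every edge is a Jordan arc (the image of an injective path) joining its two ends, an edge passes
through no vertex other than its ends, and two distinct edges meet at most in vertices. The value of
`arc` at a pair which is not an edge of `G` plays no role. -/
structure PlaneDrawing {V : Type*} (G : SimpleGraph V) where
  /-- the point at which a vertex is drawn -/
  pos : V → ℂ
  /-- the set of points of an edge, its ends included -/
  arc : Sym2 V → Set ℂ
  pos_injective : Function.Injective pos
  arc_isArc : ∀ u v : V, G.Adj u v →
    ∃ γ : Path (pos u) (pos v), Function.Injective γ ∧ Set.range γ = arc s(u, v)
  mem_of_pos_mem_arc : ∀ e ∈ G.edgeSet, ∀ w : V, pos w ∈ arc e → w ∈ e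
  arc_inter_subset : ∀ e ∈ G.edgeSet, ∀ e' ∈ G.edgeSet, e ≠ e' → arc e ∩ arc e' ⊆ Set.range pos

namespace PlaneDrawing

variable {V : Type*} {G : SimpleGraph V}

/-- The set of all points of the plane covered by the vertices and edges of the drawing. -/
def support (D : PlaneDrawing G) : Set ℂ :=
  Set.range D.pos ∪ ⋃ e ∈ G.edgeSet, D.arc e

/-- A face: a connected component of the complement of the drawing. -/
def IsFace (D : PlaneDrawing G) (F : Set ℂ) : Prop :=
  ∃ x ∈ D.supportᶜ, F = connectedComponentIn D.supportᶜ x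

/-- The finite faces: all faces other than the exterior one, that is, the bounded faces. -/
def FiniteFace (D : PlaneDrawing G) : Type :=
  {F : Set ℂ // D.IsFace F ∧ Bornology.IsBounded F}

/-- The edges of a face `F`: those edges of `G` which lie on the boundary of `F`. -/
def faceEdges (D : PlaneDrawing G) (F : Set ℂ) : Set (Sym2 V) :=
  {e | e ∈ G.edgeSet ∧ D.arc e ⊆ frontier F}

/-- The signature of a closed walk `c` (in the theorem, a cycle): to every finite face it assigns
the number of edges of that face which belong to `c`. -/
noncomputable def signature (D : PlaneDrawing G) {v : V} (c : G.Walk v v) : D.FiniteFace → ℕ :=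
  fun F => (D.faceEdges F.1 ∩ {e | e ∈ c.edges}).ncard

end PlaneDrawing

/-- The difference of two closed walks (in the theorem, cycles): the set of all edges which belong
to exactly one of the two. -/
def SimpleGraph.Walk.edgeDifference {V : Type*} {G : SimpleGraph V} {u v : V}
    (c₁ : G.Walk u u) (c₂ : G.Walk v v) : Set (Sym2 V) :=
  symmDiff {e | e ∈ c₁.edges} {e | e ∈ c₂.edges}

open Set Topology

/-! Let `A` be the set of edges of `C₁` not in `C₂`, and `B` that of `C₂` not in `C₁`. An edge of
`A` lies on exactly two faces, one inside and one outside `C₁`, both on the same side of `C₂`;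
symmetrically for `B`. Only bounded faces lie inside a cycle, and by equality of signatures each has
as many edges in `A` as in `B`. Summing over the faces inside `C₁` only, inside `C₂` only, and
inside both gives three equations: |A outside C₂| = |B inside C₁|, |A inside C₂| = |B outside C₁|,
|A inside C₂| = |B inside C₁|. So these four numbers are equal, and their sum is |A| + |B|
(`four_dvd_card_add_card`).

The topology rests on Eilenberg's criterion: a compact `K` does not separate `p` from `q` iff `(z -
p) / (z - q)` has a continuous logarithm on `K` (`hasLog_of_mem_connectedComponentIn`,
`mem_connectedComponentIn_of_hasLog`). Since logarithms glue over connected intersections, paths do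
not separate the plane; `not_isPreconnected_compl_union` shows that cycles do.
`range_subset_frontier` and `mem_connectedComponentIn_or` control what one additional arc does, and
`exists_faces_of_mem_edges` assembles the two faces at an edge. -/

/-- `g` has a continuous logarithm on `K`. -/
def HasLog (K : Set ℂ) (g : ℂ → ℂ) : Prop :=
  ∃ f : ℂ → ℂ, ContinuousOn f K ∧ ∀ z ∈ K, Complex.exp (f z) = g z

/-! ### Continuous logarithms: lifting and gluing -/

/-- Homotopy lifting for the covering `exp` of the punctured plane, starting from the constant lift
0. The parameter space will be a point, the plane, or the complement of a path. -/
theorem exists_log_lift {A : Type*} [TopologicalSpace A] (H : unitInterval × A → ℂ)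
    (hH : Continuous H) (h0 : ∀ x, H x ≠ 0) (h1 : ∀ a, H (0, a) = 1) :
    ∃ f : unitInterval × A → ℂ, Continuous f ∧ (∀ x, Complex.exp (f x) = H x) ∧
      ∀ a, f (0, a) = 0 := by
  let H' : C(unitInterval × A, {z : ℂ // z ≠ 0}) := ⟨fun x => ⟨H x, h0 x⟩, by fun_prop⟩
  have H0 : ∀ a, H' (0, a) = (fun z : ℂ ↦ (⟨_, z.exp_ne_zero⟩ : {z : ℂ // z ≠ 0}))
      ((ContinuousMap.const A (0 : ℂ)) a) := by
    intro a
    apply Subtype.ext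
    simp [H', h1]
  refine ⟨Complex.isCoveringMap_exp.liftHomotopy H' _ H0, ContinuousMap.continuous _, ?_, ?_⟩
  · intro x
    have := congr_fun (Complex.isCoveringMap_exp.liftHomotopy_lifts H' _ H0) x
    exact congr_arg Subtype.val this
  · intro a
    exact Complex.isCoveringMap_exp.liftHomotopy_zero H' _ H0 a

theorem exists_log_of_unitInterval (g : unitInterval → ℂ) (hg : Continuous g)
    (h0 : ∀ t, g t ≠ 0) : ∃ f : unitInterval → ℂ, Continuous f ∧ ∀ t, Complex.exp (f t) = g t := by
  obtain ⟨f, hf, hf', -⟩ := exists_log_lift (A := Unit) (fun x => g x.1 / g 0)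
    (by fun_prop) (fun x => div_ne_zero (h0 _) (h0 _)) (fun a => div_self (h0 _))
  refine ⟨fun t => f (t, ()) + Complex.log (g 0), by fun_prop, fun t => ?_⟩
  rw [Complex.exp_add, hf', Complex.exp_log (h0 0), div_mul_cancel₀ _ (h0 0)]

/-- The plane contracts to 0: the homotopy `g (t z) / g 0` starts at the constant 1. -/
theorem exists_log_of_plane (g : ℂ → ℂ) (hg : Continuous g) (h0 : ∀ z, g z ≠ 0) :
    ∃ f : ℂ → ℂ, Continuous f ∧ ∀ z, Complex.exp (f z) = g z := by
  obtain ⟨f, hf, hf', -⟩ := exists_log_lift (A := ℂ)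
    (fun x => g (((x.1 : ℝ) : ℂ) * x.2) / g 0)
    (by fun_prop) (fun x => div_ne_zero (h0 _) (h0 _)) (fun a => by simp [h0])
  refine ⟨fun z => f (1, z) + Complex.log (g 0), by fun_prop, fun t => ?_⟩
  rw [Complex.exp_add, hf', Complex.exp_log (h0 0), div_mul_cancel₀ _ (h0 0)]
  simp

/-- The fibre of `exp` over 1 is discrete. Applied to differences of two logarithms of one function.
-/
theorem IsPreconnected.eqOn_const_of_exp_eq_one {X : Type*} [TopologicalSpace X] {S : Set X}
    (hS : IsPreconnected S) {h : X → ℂ} (hc : ContinuousOn h S)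
    (h1 : ∀ z ∈ S, Complex.exp (h z) = 1) :
    ∃ c, Complex.exp c = 1 ∧ ∀ z ∈ S, h z = c := by
  have : IsDiscrete (Complex.exp ⁻¹' {1}) :=
    ⟨(Complex.isCoveringMapOn_exp 1 (by simp)).1⟩
  obtain ⟨y, hy, hy'⟩ := hS.eqOn_const_of_mapsTo this hc h1 ⟨0, by simp⟩
  exact ⟨y, hy, fun z hz => hy' hz⟩

namespace HasLog

theorem mono {K K' : Set ℂ} {g : ℂ → ℂ} (h : HasLog K g) (hK : K' ⊆ K) : HasLog K' g := by
  obtain ⟨f, hf, hf'⟩ := h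
  exact ⟨f, hf.mono hK, fun z hz => hf' z (hK hz)⟩

theorem congr {K : Set ℂ} {g g' : ℂ → ℂ} (h : HasLog K g) (hg : ∀ z ∈ K, g z = g' z) :
    HasLog K g' := by
  obtain ⟨f, hf, hf'⟩ := h
  exact ⟨f, hf, fun z hz => (hf' z hz).trans (hg z hz)⟩

theorem mul {K : Set ℂ} {g g' : ℂ → ℂ} (h : HasLog K g) (h' : HasLog K g') :
    HasLog K (fun z => g z * g' z) := by
  obtain ⟨f, hf, hf'⟩ := h
  obtain ⟨k, hk, hk'⟩ := h'
  exact ⟨fun z => f z + k z, hf.add hk, fun z hz => by rw [Complex.exp_add, hf' z hz, hk' z hz]⟩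

theorem inv {K : Set ℂ} {g : ℂ → ℂ} (h : HasLog K g) : HasLog K (fun z => (g z)⁻¹) := by
  obtain ⟨f, hf, hf'⟩ := h
  exact ⟨fun z => -f z, hf.neg, fun z hz => by rw [Complex.exp_neg, hf' z hz]⟩

/-- Logarithms on two sets glue if they differ by a constant on the intersection. -/
theorem union_of_sub_eq {K L : Set ℂ} {g f k : ℂ → ℂ} {c : ℂ}
    (hglue : ∀ F : ℂ → ℂ, ContinuousOn F K → ContinuousOn F L → ContinuousOn F (K ∪ L))
    (hf : ContinuousOn f K) (hf' : ∀ z ∈ K, Complex.exp (f z) = g z)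
    (hk : ContinuousOn k L) (hk' : ∀ z ∈ L, Complex.exp (k z) = g z)
    (hc : Complex.exp c = 1) (hfk : ∀ z ∈ K ∩ L, f z - k z = c) : HasLog (K ∪ L) g := by
  classical
  have hL : ∀ z ∈ L, (if z ∈ K then f z else k z + c) = k z + c := by
    intro z hz
    split_ifs with h
    · rw [← hfk z ⟨h, hz⟩]; ring
    · rfl
  refine ⟨fun z => if z ∈ K then f z else k z + c, hglue _ ?_ ?_, ?_⟩
  · exact hf.congr fun z hz => if_pos hz
  · exact (hk.add continuousOn_const).congr hL
  · rintro z (hz | hz)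
    · simp only [if_pos hz, hf' z hz]
    · simp only [hL z hz, Complex.exp_add, hk' z hz, hc, mul_one]

/-- On a connected intersection two logarithms differ by a constant, which can be absorbed. `hglue`
is kept abstract to serve pairs of closed and pairs of open sets alike. -/
theorem union_of_isPreconnected {K L : Set ℂ} {g : ℂ → ℂ}
    (hglue : ∀ F : ℂ → ℂ, ContinuousOn F K → ContinuousOn F L → ContinuousOn F (K ∪ L))
    (hK : HasLog K g) (hL : HasLog L g) (hKL : IsPreconnected (K ∩ L)) : HasLog (K ∪ L) g := by
  obtain ⟨f, hf, hf'⟩ := hK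
  obtain ⟨k, hk, hk'⟩ := hL
  obtain ⟨c, hc, hc'⟩ := hKL.eqOn_const_of_exp_eq_one (h := fun z => f z - k z)
    ((hf.mono inter_subset_left).sub (hk.mono inter_subset_right)) (fun z hz => by
      rw [Complex.exp_sub, hf' z hz.1, ← hk' z hz.2, div_self (Complex.exp_ne_zero _)])
  exact union_of_sub_eq hglue hf hf' hk hk' hc hc'

theorem union_of_isClosed {K L : Set ℂ} {g : ℂ → ℂ} (hK : HasLog K g) (hL : HasLog L g)
    (cK : IsClosed K) (cL : IsClosed L) (hKL : IsPreconnected (K ∩ L)) : HasLog (K ∪ L) g :=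
  union_of_isPreconnected (fun _ h h' => h.union_of_isClosed h' cK cL) hK hL hKL

theorem union_of_isOpen {K L : Set ℂ} {g : ℂ → ℂ} (hK : HasLog K g) (hL : HasLog L g)
    (cK : IsOpen K) (cL : IsOpen L) (hKL : IsPreconnected (K ∩ L)) : HasLog (K ∪ L) g :=
  union_of_isPreconnected (fun _ h h' => h.union_of_isOpen h' cK cL) hK hL hKL

end HasLog

/-- A continuous function without zeros has a logarithm on every arc. -/
theorem hasLog_range_of_injective {γ : unitInterval → ℂ} (hγ : Continuous γ)
    (hinj : Function.Injective γ) {g : ℂ → ℂ} (hg : ContinuousOn g (range γ))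
    (h0 : ∀ z ∈ range γ, g z ≠ 0) : HasLog (range γ) g := by
  obtain ⟨l, hl, hl'⟩ := exists_log_of_unitInterval (g ∘ γ)
    (hg.comp_continuous hγ fun t => mem_range_self t) (fun t => h0 _ (mem_range_self t))
  let e := (hγ.isClosedEmbedding hinj).isEmbedding.toHomeomorph
  classical
  refine ⟨fun z => if h : z ∈ range γ then l (e.symm ⟨z, h⟩) else 0, ?_, ?_⟩
  · rw [continuousOn_iff_continuous_domRestrict]
    convert hl.comp e.symm.continuous using 1
    ext ⟨z, hz⟩
    simp [Set.domRestrict, hz]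
  · rintro _ ⟨t, rfl⟩
    have : e.symm ⟨γ t, mem_range_self t⟩ = t := by
      rw [Homeomorph.symm_apply_eq]; rfl
    simp only [mem_range_self, dif_pos, this, hl', Function.comp]

/-! ### Components of the complement of a compact set -/

/-- A power of `z - p` has a logarithm on a circle around `p` only if the exponent is zero. -/
theorem eq_zero_of_hasLog_sphere {p : ℂ} {r : ℝ} (hr : 0 < r) {n : ℤ}
    (h : HasLog (Metric.sphere p r) fun z => (z - p) ^ n) : n = 0 := by
  obtain ⟨f, hf, hf'⟩ := h
  have hmem : ∀ t : ℝ, p + r * Complex.exp (t * Complex.I) ∈ Metric.sphere p r := by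
    intro t
    simp [Complex.norm_exp_ofReal_mul_I, hr.le]
  have hcont : Continuous fun t : ℝ => f (p + r * Complex.exp (t * Complex.I)) :=
    hf.comp_continuous (by fun_prop) hmem
  have hr0 : (r : ℂ) ≠ 0 := by exact_mod_cast hr.ne'
  -- In the angle `t`, the given logarithm differs from `n (log r + i t)` by a constant; comparing
  -- `t = 0` with `t = 2π` gives `2πi n = 0`.
  obtain ⟨c, -, hc⟩ := (isPreconnected_univ (α := ℝ)).eqOn_const_of_exp_eq_one
    (h := fun t : ℝ => f (p + r * Complex.exp (t * Complex.I)) - n * (t * Complex.I)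
      - n * Complex.log r) ((hcont.sub (by fun_prop)).sub continuous_const).continuousOn
    (fun t _ => by
      simp only [Complex.exp_sub, Complex.exp_sub, hf' _ (hmem t), Complex.exp_int_mul,
        Complex.exp_log hr0, add_sub_cancel_left, mul_zpow]
      have := zpow_ne_zero n hr0
      have := zpow_ne_zero n (Complex.exp_ne_zero (t * Complex.I))
      field_simp)
  have h1 := hc 0 trivial
  have h2 := hc (2 * Real.pi) trivial
  rw [← h2] at h1
  simp only [Complex.ofReal_mul, Complex.ofReal_ofNat, Complex.exp_two_pi_mul_I,
    Complex.ofReal_zero, zero_mul, Complex.exp_zero] at h1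
  have h3 : (n : ℂ) * (2 * Real.pi * Complex.I) = 0 := by linear_combination h1
  have h4 : (2 * Real.pi * Complex.I : ℂ) ≠ 0 := Complex.two_pi_I_ne_zero
  exact_mod_cast (mul_eq_zero.mp h3).resolve_right h4

theorem isPreconnected_compl_closedBall_zero {R : ℝ} :
    IsPreconnected (Metric.closedBall (0 : ℂ) R)ᶜ := by
  have : (Metric.closedBall (0 : ℂ) R)ᶜ =
      (fun x : ℝ × ℝ => (x.1 : ℂ) * Complex.exp (x.2 * Complex.I)) '' (Ioi R ×ˢ univ) := by
    ext z
    simp only [mem_compl_iff, mem_closedBall_zero_iff, not_le, mem_image, mem_prod, mem_Ioi,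
      mem_univ, and_true, Prod.exists]
    constructor
    · intro h
      exact ⟨‖z‖, z.arg, h, z.norm_mul_exp_arg_mul_I⟩
    · rintro ⟨r, t, hr, rfl⟩
      rw [norm_mul, Complex.norm_exp_ofReal_mul_I, mul_one, Complex.norm_real]
      exact hr.trans_le (le_abs_self r)
  rw [this]
  refine (isPreconnected_Ioi.prod isPreconnected_univ).image _ (Continuous.continuousOn ?_)
  fun_prop

/-- The complement of a compact set has exactly one unbounded component. -/
theorem exists_unbounded_connectedComponentIn {K : Set ℂ} (hK : IsCompact K) :
    ∃ r ∈ Kᶜ, ¬ Bornology.IsBounded (connectedComponentIn Kᶜ r) ∧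
      ∀ p, ¬ Bornology.IsBounded (connectedComponentIn Kᶜ p) → r ∈ connectedComponentIn Kᶜ p := by
  obtain ⟨R, hR0, hR⟩ := hK.isBounded.subset_closedBall_lt 0 (0 : ℂ)
  have hS : (Metric.closedBall (0 : ℂ) R)ᶜ ⊆ Kᶜ := compl_subset_compl.mpr hR
  have hpre := isPreconnected_compl_closedBall_zero (R := R)
  have hr : (((R + 1 : ℝ) : ℂ)) ∈ (Metric.closedBall (0 : ℂ) R)ᶜ := by
    simp only [mem_compl_iff, mem_closedBall_zero_iff, Complex.norm_real, not_le]
    exact (lt_add_one R).trans_le (le_abs_self _)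
  refine ⟨_, hS hr, fun hb => ?_, fun p hp => ?_⟩
  · have hb' := hb.subset (hpre.subset_connectedComponentIn hr hS)
    have := hb'.union (Metric.isBounded_closedBall (x := (0 : ℂ)) (r := R))
    rw [compl_union_self] at this
    exact NormedSpace.unbounded_univ ℂ ℂ this
  · have : ∃ z ∈ connectedComponentIn Kᶜ p, z ∈ (Metric.closedBall (0 : ℂ) R)ᶜ := by
      by_contra! h
      exact hp (Metric.isBounded_closedBall.subset fun z hz => not_not.mp (h z hz))
    obtain ⟨z, hz, hz'⟩ := this
    rw [connectedComponentIn_eq hz]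
    exact hpre.subset_connectedComponentIn hz' hS hr

theorem mem_connectedComponentIn_comm {X : Type*} [TopologicalSpace X] {S : Set X} {p q : X}
    (h : q ∈ connectedComponentIn S p) : p ∈ connectedComponentIn S q := by
  rw [← connectedComponentIn_eq h]
  exact mem_connectedComponentIn (connectedComponentIn_nonempty_iff.mp ⟨q, h⟩)

/-- Of two different components of the complement of a compact set, one is bounded. -/
theorem isBounded_or_isBounded_of_notMem {K : Set ℂ} (hK : IsCompact K) {p q : ℂ}
    (hpq : q ∉ connectedComponentIn Kᶜ p) :
    Bornology.IsBounded (connectedComponentIn Kᶜ p) ∨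
      Bornology.IsBounded (connectedComponentIn Kᶜ q) := by
  obtain ⟨r, -, -, h⟩ := exists_unbounded_connectedComponentIn hK
  by_contra! h'
  have h1 := h p h'.1
  have h2 := h q h'.2
  rw [connectedComponentIn_eq h1] at hpq
  exact hpq (mem_connectedComponentIn_comm h2)

/-- Components of an open set are open: a frontier point off `K` would have a component meeting,
hence equal to, that of `p`. -/
theorem frontier_connectedComponentIn_subset {K : Set ℂ} (hK : IsClosed K) {p : ℂ} :
    frontier (connectedComponentIn Kᶜ p) ⊆ K := by
  intro z hz
  by_contra hzK
  have ho : IsOpen (connectedComponentIn Kᶜ z) := hK.isOpen_compl.connectedComponentIn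
  obtain ⟨w, hw, hw'⟩ := mem_closure_iff.mp (frontier_subset_closure hz) _ ho
    (mem_connectedComponentIn hzK)
  have := connectedComponentIn_eq hw
  rw [← connectedComponentIn_eq hw'] at this
  have hz2 : z ∈ connectedComponentIn Kᶜ p := this ▸ mem_connectedComponentIn hzK
  rw [IsOpen.frontier_eq hK.isOpen_compl.connectedComponentIn] at hz
  exact hz.2 hz2

theorem sub_ne_zero_of_mem_closure_connectedComponentIn {K : Set ℂ} (hK : IsClosed K) {p q : ℂ}
    (hq : q ∉ K) (hpq : q ∉ connectedComponentIn Kᶜ p) :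
    ∀ z ∈ closure (connectedComponentIn Kᶜ p), z - q ≠ 0 := by
  intro z hz h0
  rw [sub_eq_zero] at h0
  subst h0
  rw [closure_eq_self_union_frontier] at hz
  exact hz.elim hpq fun hz => hq (frontier_connectedComponentIn_subset hK hz)

/-- If `p` lies in a bounded component `U` of the complement of `K`, then a nonzero power of
`z - p`, multiplied by a function without zeros on the closure of `U`, has no logarithm on `K`. -/
theorem eq_zero_of_hasLog {K : Set ℂ} (hK : IsCompact K) {p : ℂ} (hp : p ∉ K)
    (hb : Bornology.IsBounded (connectedComponentIn Kᶜ p)) {n : ℤ} {g : ℂ → ℂ}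
    (hg : ContinuousOn g (closure (connectedComponentIn Kᶜ p)))
    (hg0 : ∀ z ∈ closure (connectedComponentIn Kᶜ p), g z ≠ 0)
    (h : HasLog K fun z => (z - p) ^ n * g z) : n = 0 := by
  classical
  set U := connectedComponentIn Kᶜ p with hU
  have hpU : p ∈ U := mem_connectedComponentIn hp
  have hUo : IsOpen U := hK.isClosed.isOpen_compl.connectedComponentIn
  obtain ⟨f, hf, hf'⟩ := h
  -- Tietze extension of the logarithm to the whole plane.
  obtain ⟨F, hF⟩ := ContinuousMap.exists_restrict_eq hK.isClosed
    ⟨K.domRestrict f, continuousOn_iff_continuous_domRestrict.mp hf⟩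
  have hF' : ∀ z ∈ K, F z = f z := fun z hz => by
    have := congrArg (fun φ => φ ⟨z, hz⟩) hF
    simpa using this
  -- The two formulas agree on the frontier of `U`, which lies in `K`. So `G` is continuous without
  -- zeros and has a logarithm on the plane, although it equals `(z - p) ^ n` on a large circle.
  let G : ℂ → ℂ := fun z => if z ∈ U then Complex.exp (F z) / g z else (z - p) ^ n
  have hG : ∀ z ∈ closure U, G z = Complex.exp (F z) / g z := by
    intro z hz
    by_cases hzU : z ∈ U
    · exact if_pos hzU
    · have hzK : z ∈ K := frontier_connectedComponentIn_subset hK.isClosed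
        (by rw [IsOpen.frontier_eq hUo]; exact ⟨hz, hzU⟩)
      simp only [G, if_neg hzU]
      rw [hF' z hzK, hf' z hzK, mul_div_cancel_right₀ _ (hg0 z hz)]
  have hne : ∀ z ∉ U, z - p ≠ 0 := fun z hz h0 => hz (sub_eq_zero.mp h0 ▸ hpU)
  have hGc : Continuous G := by
    have hun : closure U ∪ Uᶜ = univ := univ_subset_iff.mp
      ((union_compl_self U).symm.subset.trans (union_subset_union_left _ subset_closure))
    rw [← continuousOn_univ, ← hun]
    refine ContinuousOn.union_of_isClosed ?_ ?_ isClosed_closure hUo.isClosed_compl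
    · exact ((Complex.continuous_exp.comp F.continuous).continuousOn.div hg hg0).congr hG
    · refine ContinuousOn.congr (f := fun z => (z - p) ^ n) ?_ fun z hz => if_neg hz
      exact ContinuousOn.zpow₀ (by fun_prop) n fun z hz => Or.inl (hne z hz)
  have hG0 : ∀ z, G z ≠ 0 := by
    intro z
    by_cases hz : z ∈ U
    · rw [hG z (subset_closure hz)]
      exact div_ne_zero (Complex.exp_ne_zero _) (hg0 z (subset_closure hz))
    · simp only [G, if_neg hz]
      exact zpow_ne_zero _ (hne z hz)
  obtain ⟨l, hl, hl'⟩ := exists_log_of_plane G hGc hG0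
  obtain ⟨R, hR0, hR⟩ := hb.subset_ball_lt 0 p
  refine eq_zero_of_hasLog_sphere (p := p) hR0 ⟨l, hl.continuousOn, fun z hz => ?_⟩
  rw [hl']
  refine if_neg fun hzU => ?_
  have := hR hzU
  rw [Metric.mem_ball] at this
  rw [Metric.mem_sphere] at hz
  linarith

/-- Points which are not separated by a compact set `K`: the quotient of the distances has a
logarithm on `K`. -/
theorem hasLog_of_mem_connectedComponentIn {K : Set ℂ} (hK : IsCompact K) {p q : ℂ}
    (h : q ∈ connectedComponentIn Kᶜ p) : HasLog K fun z => (z - p) / (z - q) := by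
  have hne : ∀ x ∈ connectedComponentIn Kᶜ p, ∀ z ∈ K, z - x ≠ 0 := fun x hx z hz h0 =>
    connectedComponentIn_subset Kᶜ p hx (sub_eq_zero.mp h0 ▸ hz)
  -- The relation is symmetric and transitive, so it need only be checked locally: if `y` is closer
  -- to `x` than `K` is, then `(z - y) / (z - x)` stays in the unit disc about 1, where the
  -- principal logarithm is continuous.
  refine isPreconnected_connectedComponentIn.induction₂
    (fun q p => HasLog K fun z => (z - p) / (z - q)) ?_ ?_ ?_ h
    (mem_connectedComponentIn (connectedComponentIn_nonempty_iff.mp ⟨q, h⟩))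
  · intro x hx
    obtain ⟨ε, hε, hball⟩ := Metric.isOpen_iff.mp hK.isClosed.isOpen_compl x
      (connectedComponentIn_subset Kᶜ p hx)
    filter_upwards [mem_nhdsWithin_of_mem_nhds (Metric.ball_mem_nhds x hε)] with y hy
    have hlt : ∀ z ∈ K, ‖(x - y) / (z - x)‖ < 1 := by
      intro z hz
      rw [norm_div, div_lt_one (norm_pos_iff.mpr (hne x hx z hz))]
      have h1 : ε ≤ dist z x := not_lt.mp fun h => hball (Metric.mem_ball.mpr h) hz
      rw [Metric.mem_ball, dist_comm, dist_eq_norm] at hy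
      rw [dist_eq_norm] at h1
      exact hy.trans_le h1
    refine ⟨fun z => Complex.log (1 + (x - y) / (z - x)), ?_, fun z hz => ?_⟩
    · refine ContinuousOn.clog ?_ fun z hz => Complex.mem_slitPlane_of_norm_lt_one (hlt z hz)
      exact continuousOn_const.add (ContinuousOn.div (by fun_prop) (by fun_prop) (hne x hx))
    · have h0 := hne x hx z hz
      rw [Complex.exp_log (Complex.slitPlane_ne_zero
        (Complex.mem_slitPlane_of_norm_lt_one (hlt z hz)))]
      field_simp
      ring
  · intro x y z _ hy _ h1 h2
    refine (h2.mul h1).congr fun w hw => ?_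
    rw [div_mul_div_cancel₀ (hne y hy w hw)]
  · intro x y _ _ h
    exact h.inv.congr fun w _ => by rw [inv_div]

/-- Points are not separated by `K` if the quotient of the distances has a logarithm on `K`. -/
theorem mem_connectedComponentIn_of_hasLog {K : Set ℂ} (hK : IsCompact K) {p q : ℂ}
    (hp : p ∉ K) (hq : q ∉ K) (h : HasLog K fun z => (z - p) / (z - q)) :
    q ∈ connectedComponentIn Kᶜ p := by
  have key : ∀ {p q : ℂ}, p ∉ K → q ∉ K → HasLog K (fun z => (z - p) / (z - q)) →
      q ∉ connectedComponentIn Kᶜ p → ¬ Bornology.IsBounded (connectedComponentIn Kᶜ p) := by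
    intro p q hp hq h hpq hb
    have hne := sub_ne_zero_of_mem_closure_connectedComponentIn hK.isClosed hq hpq
    have := eq_zero_of_hasLog hK hp hb (n := 1) (g := fun z => (z - q)⁻¹)
      (ContinuousOn.inv₀ (by fun_prop) hne) (fun z hz => inv_ne_zero (hne z hz))
      (h.congr fun z _ => by rw [zpow_one, div_eq_mul_inv])
    exact one_ne_zero this
  by_contra hpq
  rcases isBounded_or_isBounded_of_notMem hK hpq with hb | hb
  · exact key hp hq h hpq hb
  · refine key hq hp (h.inv.congr fun z _ => by rw [inv_div]) (fun h => hpq ?_) hb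
    exact mem_connectedComponentIn_comm h

/-- By Eilenberg's criterion this says that an arc does not separate the plane. -/
theorem hasLog_sub_div_sub_of_injective {γ : unitInterval → ℂ} (hγ : Continuous γ)
    (hinj : Function.Injective γ) {p q : ℂ} (hp : p ∉ range γ) (hq : q ∉ range γ) :
    HasLog (range γ) fun z => (z - p) / (z - q) := by
  have hne : ∀ x ∉ range γ, ∀ z ∈ range γ, z - x ≠ 0 := fun x hx z hz h0 =>
    hx (sub_eq_zero.mp h0 ▸ hz)
  exact hasLog_range_of_injective hγ hinj (ContinuousOn.div (by fun_prop) (by fun_prop) (hne q hq))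
    fun z hz => div_ne_zero (hne p hp z hz) (hne q hq z hz)

/-! ### Adding an arc; separation by two continua -/

/-- Adding an arc `γ` with its ends on `L` to a compact set `L`: if this separates `p` from `q`,
then all of the arc belongs to the frontier of the component of `p`. -/
theorem range_subset_frontier {L : Set ℂ} (hL : IsCompact L) {γ : unitInterval → ℂ}
    (hγ : Continuous γ) (hinj : Function.Injective γ) (hγL : ∀ t, γ t ∈ L → t = 0 ∨ t = 1)
    {p q : ℂ} (hp : p ∉ L ∪ range γ) (hq : q ∉ L ∪ range γ)
    (hpq : q ∈ connectedComponentIn Lᶜ p) (hsep : q ∉ connectedComponentIn (L ∪ range γ)ᶜ p) :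
    range γ ⊆ frontier (connectedComponentIn (L ∪ range γ)ᶜ p) := by
  have hK : IsCompact (L ∪ range γ) := hL.union (isCompact_range hγ)
  set F := connectedComponentIn (L ∪ range γ)ᶜ p with hF
  have hFo : IsOpen F := hK.isClosed.isOpen_compl.connectedComponentIn
  have hFK : F ⊆ (L ∪ range γ)ᶜ := connectedComponentIn_subset _ _
  suffices h : range γ ⊆ closure F by
    intro z hz
    rw [hFo.frontier_eq]
    exact ⟨h hz, fun hzF => hFK hzF (Or.inr hz)⟩
  rintro _ ⟨t₁, rfl⟩
  by_contra ht₁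
  have hO : IsOpen {t | γ t ∉ closure F} := isClosed_closure.isOpen_compl.preimage hγ
  obtain ⟨ε, hε, hball⟩ := Metric.isOpen_iff.mp hO t₁ ht₁
  -- If one point of the arc misses the closed set `closure F`, so does a whole open subarc.
  obtain ⟨s, t, hst, hgap⟩ : ∃ s t : unitInterval, s < t ∧ ∀ x, s < x → x < t → γ x ∉ closure F := by
    have h0 := t₁.2.1
    have h1 := t₁.2.2
    refine ⟨⟨max 0 (t₁ - ε / 2), le_max_left _ _, max_le zero_le_one (by linarith)⟩,
      ⟨min 1 (t₁ + ε / 2), le_min zero_le_one (by linarith), min_le_left _ _⟩, ?_, ?_⟩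
    · change max 0 ((t₁ : ℝ) - ε / 2) < min 1 (t₁ + ε / 2)
      rw [max_lt_iff, lt_min_iff, lt_min_iff]
      exact ⟨⟨one_pos, by linarith⟩, by linarith, by linarith⟩
    · intro x hx hx'
      rw [← Subtype.coe_lt_coe, max_lt_iff] at hx
      rw [← Subtype.coe_lt_coe, lt_min_iff] at hx'
      apply hball
      rw [Metric.mem_ball, Subtype.dist_eq, Real.dist_eq, abs_lt]
      exact ⟨by linarith [hx.2], by linarith [hx'.2]⟩
  have hA : IsCompact (γ '' Iic s) := isClosed_Iic.isCompact.image hγ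
  have hB : IsCompact (γ '' Ici t) := isClosed_Ici.isCompact.image hγ
  have hK'K : L ∪ γ '' Iic s ∪ γ '' Ici t ⊆ L ∪ range γ := by
    rw [union_assoc]
    exact union_subset_union_right _ (union_subset (image_subset_range _ _) (image_subset_range _ _))
  have hp2 : p ∉ range γ := fun h => hp (Or.inr h)
  have hq2 : q ∉ range γ := fun h => hq (Or.inr h)
  have hlog := hasLog_sub_div_sub_of_injective hγ hinj hp2 hq2
  -- With the gap removed, each remaining subarc meets the rest in at most one point, so the
  -- logarithms glue and `p`, `q` are no longer separated.
  have h1 : HasLog (L ∪ γ '' Iic s ∪ γ '' Ici t) fun z => (z - p) / (z - q) := by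
    refine HasLog.union_of_isClosed (HasLog.union_of_isClosed
      (hasLog_of_mem_connectedComponentIn hL hpq) (hlog.mono (image_subset_range _ _))
      hL.isClosed hA.isClosed ?_) (hlog.mono (image_subset_range _ _))
      (hL.union hA).isClosed hB.isClosed ?_
    · apply Set.Subsingleton.isPreconnected
      refine subsingleton_of_subset_singleton (a := γ 0) ?_
      rintro _ ⟨hz, x, hx, rfl⟩
      rcases hγL x hz with rfl | rfl
      · rfl
      · exact absurd (lt_of_le_of_lt hx hst) (not_lt.mpr unitInterval.le_one')
    · apply Set.Subsingleton.isPreconnected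
      refine subsingleton_of_subset_singleton (a := γ 1) ?_
      rintro _ ⟨hz | ⟨y, hy, hxy⟩, x, hx, rfl⟩
      · rcases hγL x hz with rfl | rfl
        · exact absurd (lt_of_lt_of_le hst hx) (not_lt.mpr unitInterval.nonneg')
        · rfl
      · exact absurd (hinj hxy ▸ hst.trans_le hx) (not_lt.mpr hy)
  have h2 := mem_connectedComponentIn_of_hasLog ((hL.union hA).union hB)
    (fun h => hp (hK'K h)) (fun h => hq (hK'K h)) h1
  have hpre := isPreconnected_connectedComponentIn
    (x := p) (F := (L ∪ γ '' Iic s ∪ γ '' Ici t)ᶜ)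
  have hp3 := mem_connectedComponentIn
    (show p ∈ (L ∪ γ '' Iic s ∪ γ '' Ici t)ᶜ from fun h => hp (hK'K h))
  -- Leaving `F` would require crossing its frontier inside the gap, but the gap avoids `closure F`.
  -- So the component of `p` stays in `F` and cannot contain `q`.
  have hdisj : connectedComponentIn (L ∪ γ '' Iic s ∪ γ '' Ici t)ᶜ p ⊆ F ∪ (closure F)ᶜ := by
    intro z hz
    by_contra! hz'
    simp only [mem_union, mem_compl_iff, not_or, not_not] at hz'
    have hzfr : z ∈ frontier F := by rw [hFo.frontier_eq]; exact ⟨hz'.2, hz'.1⟩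
    have hzK' := connectedComponentIn_subset _ _ hz
    rcases frontier_connectedComponentIn_subset hK.isClosed hzfr with hzL | ⟨x, rfl⟩
    · exact hzK' (Or.inl (Or.inl hzL))
    · refine hgap x (not_le.mp fun h => ?_) (not_le.mp fun h => ?_) hz'.2
      · exact hzK' (Or.inl (Or.inr ⟨x, h, rfl⟩))
      · exact hzK' (Or.inr ⟨x, h, rfl⟩)
  have hsub := hpre.subset_left_of_subset_union hFo isClosed_closure.isOpen_compl
    (disjoint_compl_right.mono_left subset_closure) hdisj ⟨p, hp3, mem_connectedComponentIn hp⟩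
  exact hsep (hsub h2)

/-- Two logarithms of the same function, on a set and on an arc with its ends in this set, can be
chosen such that they agree at one end; at the other end they differ by a multiple of `2πi`. -/
theorem HasLog.exists_jump {L E : Set ℂ} {g : ℂ → ℂ} (hL : HasLog L g) (hE : HasLog E g)
    {a b : ℂ} (haL : a ∈ L) (hbL : b ∈ L) (haE : a ∈ E) (hbE : b ∈ E) :
    ∃ (d : ℤ) (f k : ℂ → ℂ), ContinuousOn f L ∧ (∀ z ∈ L, Complex.exp (f z) = g z) ∧
      ContinuousOn k E ∧ (∀ z ∈ E, Complex.exp (k z) = g z) ∧ f a = k a ∧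
      f b - k b = d * (2 * Real.pi * Complex.I) := by
  obtain ⟨f, hf, hf'⟩ := hL
  obtain ⟨k, hk, hk'⟩ := hE
  have hexp : Complex.exp (f a - k a) = 1 := by
    rw [Complex.exp_sub, hf' a haL, ← hk' a haE, div_self (Complex.exp_ne_zero _)]
  have hk2 : ∀ z ∈ E, Complex.exp (k z + (f a - k a)) = g z := fun z hz => by
    rw [Complex.exp_add, hexp, mul_one, hk' z hz]
  obtain ⟨d, hd⟩ := Complex.exp_eq_exp_iff_exists_int.mp ((hf' b hbL).trans (hk2 b hbE).symm)
  exact ⟨d, f, fun z => k z + (f a - k a), hf, hf', hk.add continuousOn_const, hk2,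
    by ring, by rw [hd]; ring⟩

/-- Adding an arc `γ` with its ends on a compact set `L` divides a component of the complement of
`L` into at most two components. -/
theorem mem_connectedComponentIn_or {L : Set ℂ} (hL : IsCompact L) {γ : unitInterval → ℂ}
    (hγ : Continuous γ) (hinj : Function.Injective γ) (hγL : ∀ t, γ t ∈ L ↔ t = 0 ∨ t = 1)
    {p q r : ℂ} (hp : p ∉ L ∪ range γ) (hq : q ∉ L ∪ range γ) (hr : r ∉ L ∪ range γ)
    (hpr : r ∈ connectedComponentIn Lᶜ p) (hqr : r ∈ connectedComponentIn Lᶜ q)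
    (hpq : q ∉ connectedComponentIn (L ∪ range γ)ᶜ p) :
    r ∈ connectedComponentIn (L ∪ range γ)ᶜ p ∨ r ∈ connectedComponentIn (L ∪ range γ)ᶜ q := by
  have hE : IsCompact (range γ) := isCompact_range hγ
  have hK : IsCompact (L ∪ range γ) := hL.union hE
  have haL : γ 0 ∈ L := (hγL 0).mpr (Or.inl rfl)
  have hbL : γ 1 ∈ L := (hγL 1).mpr (Or.inr rfl)
  have hLE : ∀ {P : ℂ → Prop}, P (γ 0) → P (γ 1) → ∀ z ∈ L ∩ range γ, P z := by
    rintro P h0 h1 _ ⟨hz, t, rfl⟩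
    rcases (hγL t).mp hz with rfl | rfl
    · exact h0
    · exact h1
  have hglue : ∀ F : ℂ → ℂ, ContinuousOn F L → ContinuousOn F (range γ) →
      ContinuousOn F (L ∪ range γ) := fun _ h h' => h.union_of_isClosed h' hL.isClosed hE.isClosed
  have hE2 : ∀ {x}, x ∉ L ∪ range γ → x ∉ range γ := fun h h' => h (Or.inr h')
  obtain ⟨d, f, k, hf, hf', hk, hk', hfk, hd⟩ := (hasLog_of_mem_connectedComponentIn hL hpr).exists_jump
    (hasLog_sub_div_sub_of_injective hγ hinj (hE2 hp) (hE2 hr)) haL hbL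
    (mem_range_self 0) (mem_range_self 1)
  obtain ⟨e, l, m, hl, hl', hm, hm', hlm, he⟩ :=
    (hasLog_of_mem_connectedComponentIn hL hqr).exists_jump
    (hasLog_sub_div_sub_of_injective hγ hinj (hE2 hq) (hE2 hr)) haL hbL
    (mem_range_self 0) (mem_range_self 1)
  by_contra! hcon
  -- Without a jump at `γ 1` the logarithms would glue, and `p` and `r` would not be separated.
  have hd0 : d ≠ 0 := by
    rintro rfl
    refine hcon.1 (mem_connectedComponentIn_of_hasLog hK hp hr ?_)
    refine HasLog.union_of_sub_eq hglue hf hf' hk hk' Complex.exp_zero (hLE ?_ ?_)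
    · rw [hfk, sub_self]
    · simpa using hd
  have he0 : e ≠ 0 := by
    rintro rfl
    refine hcon.2 (mem_connectedComponentIn_of_hasLog hK hq hr ?_)
    refine HasLog.union_of_sub_eq hglue hl hl' hm hm' Complex.exp_zero (hLE ?_ ?_)
    · rw [hlm, sub_self]
    · simpa using he
  -- The exponents `e` and `-d` make the jumps `d` and `e` cancel. On a bounded component of `p` or
  -- `q`, `eq_zero_of_hasLog` then forces the corresponding exponent to vanish.
  have hlog : HasLog (L ∪ range γ) fun z =>
      ((z - p) / (z - r)) ^ e * ((z - q) / (z - r)) ^ (-d) := by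
    refine HasLog.union_of_sub_eq (f := fun z => e * f z + (-d : ℤ) * l z)
      (k := fun z => e * k z + (-d : ℤ) * m z) hglue (by fun_prop) (fun z hz => ?_) (by fun_prop)
      (fun z hz => ?_) Complex.exp_zero (hLE ?_ ?_)
    · rw [Complex.exp_add, Complex.exp_int_mul, Complex.exp_int_mul, hf' z hz, hl' z hz]
    · rw [Complex.exp_add, Complex.exp_int_mul, Complex.exp_int_mul, hk' z hz, hm' z hz]
    · rw [hfk, hlm, sub_self]
    · push_cast
      linear_combination (e : ℂ) * hd - (d : ℂ) * he
  have hcont : ∀ {x : ℂ} {S : Set ℂ}, ContinuousOn (fun z : ℂ => z - x) S := by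
    intro x S; fun_prop
  have hqp : p ∉ connectedComponentIn (L ∪ range γ)ᶜ q :=
    fun h => hpq (mem_connectedComponentIn_comm h)
  rcases isBounded_or_isBounded_of_notMem hK hpq with hb | hb
  · have hq' := sub_ne_zero_of_mem_closure_connectedComponentIn hK.isClosed hq hpq
    have hr' := sub_ne_zero_of_mem_closure_connectedComponentIn hK.isClosed hr hcon.1
    refine he0 (eq_zero_of_hasLog hK hp hb
      (g := fun z => (z - r) ^ (-e) * ((z - q) / (z - r)) ^ (-d)) ?_ ?_ ?_)
    · exact (hcont.zpow₀ _ fun z hz => Or.inl (hr' z hz)).mul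
        ((hcont.div hcont hr').zpow₀ _ fun z hz => Or.inl (div_ne_zero (hq' z hz) (hr' z hz)))
    · exact fun z hz => mul_ne_zero (zpow_ne_zero _ (hr' z hz))
        (zpow_ne_zero _ (div_ne_zero (hq' z hz) (hr' z hz)))
    · refine hlog.congr fun z _ => ?_
      rw [div_zpow _ _ e, zpow_neg (z - r) e]
      ring
  · have hp' := sub_ne_zero_of_mem_closure_connectedComponentIn hK.isClosed hp hqp
    have hr' := sub_ne_zero_of_mem_closure_connectedComponentIn hK.isClosed hr hcon.2
    refine hd0 (neg_eq_zero.mp (eq_zero_of_hasLog hK hq hb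
      (g := fun z => (z - r) ^ (-(-d)) * ((z - p) / (z - r)) ^ e) ?_ ?_ ?_))
    · exact (hcont.zpow₀ _ fun z hz => Or.inl (hr' z hz)).mul
        ((hcont.div hcont hr').zpow₀ _ fun z hz => Or.inl (div_ne_zero (hp' z hz) (hr' z hz)))
    · exact fun z hz => mul_ne_zero (zpow_ne_zero _ (hr' z hz))
        (zpow_ne_zero _ (div_ne_zero (hp' z hz) (hr' z hz)))
    · refine hlog.congr fun z _ => ?_
      rw [div_zpow _ _ (-d), zpow_neg _ (-d)]
      ring

/-- On the complement of a path from `a` to `b`, the function `(z - a) / (z - b)` has a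
logarithm. -/
theorem hasLog_compl_range {γ : unitInterval → ℂ} (hγ : Continuous γ) :
    HasLog (range γ)ᶜ fun z => (z - γ 0) / (z - γ 1) := by
  classical
  have hne : ∀ (t : unitInterval) (z : ((range γ)ᶜ : Set ℂ)), (z : ℂ) - γ t ≠ 0 := fun t z h0 =>
    z.2 (sub_eq_zero.mp h0 ▸ mem_range_self t)
  -- Slide the pole along the path: `(z - γ 0) / (z - γ t)` is 1 at `t = 0` and the desired quotient
  -- at `t = 1`.
  obtain ⟨f, hf, hf', -⟩ := exists_log_lift (A := ((range γ)ᶜ : Set ℂ))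
    (fun x => ((x.2 : ℂ) - γ 0) / (x.2 - γ x.1)) (Continuous.div (by fun_prop) (by fun_prop)
      fun x => hne _ _) (fun x => div_ne_zero (hne _ _) (hne _ _)) (fun z => div_self (hne _ _))
  refine ⟨fun z => if h : z ∈ (range γ)ᶜ then f (1, ⟨z, h⟩) else 0, ?_, fun z hz => ?_⟩
  · rw [continuousOn_iff_continuous_domRestrict]
    convert! hf.comp (Continuous.prodMk_right (1 : unitInterval)) using 1
    ext ⟨z, hz⟩
    simp only [Set.domRestrict, dif_pos hz, Function.comp]
  · simp only [dif_pos hz, hf']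

/-- Two continua from `a` to `b` which meet in these points only separate the plane. -/
theorem not_isPreconnected_compl_union {L E : Set ℂ} (hL : IsClosed L) (hE : IsClosed E) {a b : ℂ}
    (hab : a ≠ b) (hLE : L ∩ E ⊆ {a, b}) (hL' : HasLog Lᶜ fun z => (z - a) / (z - b))
    (hE' : HasLog Eᶜ fun z => (z - a) / (z - b)) : ¬ IsPreconnected (L ∪ E)ᶜ := by
  intro h
  rw [compl_union] at h
  -- A connected intersection of the complements would give a logarithm off `L ∩ E`, in particular
  -- on a small circle about `a`. There `z - b` has a logarithm, so `z - a` would have one too.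
  have h1 := HasLog.union_of_isOpen hL' hE' hL.isOpen_compl hE.isOpen_compl h
  have hr : 0 < ‖a - b‖ / 2 := by
    have := norm_pos_iff.mpr (sub_ne_zero.mpr hab)
    positivity
  have hab' : a - b ≠ 0 := sub_ne_zero.mpr hab
  have hlt : ∀ z ∈ Metric.sphere a (‖a - b‖ / 2), ‖(z - a) / (a - b)‖ < 1 := by
    intro z hz
    rw [mem_sphere_iff_norm] at hz
    rw [norm_div, hz, div_lt_one (norm_pos_iff.mpr hab')]
    linarith
  have h2 : HasLog (Metric.sphere a (‖a - b‖ / 2)) fun z => z - b := by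
    refine ⟨fun z => Complex.log (a - b) + Complex.log (1 + (z - a) / (a - b)), ?_, fun z hz => ?_⟩
    · refine continuousOn_const.add (ContinuousOn.clog ?_
        fun z hz => Complex.mem_slitPlane_of_norm_lt_one (hlt z hz))
      fun_prop
    · rw [Complex.exp_add, Complex.exp_log hab', Complex.exp_log (Complex.slitPlane_ne_zero
        (Complex.mem_slitPlane_of_norm_lt_one (hlt z hz)))]
      field_simp
      ring
  have hzb : ∀ z ∈ Metric.sphere a (‖a - b‖ / 2), z - b ≠ 0 := by
    intro z hz h0
    obtain ⟨f, -, hf⟩ := h2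
    exact Complex.exp_ne_zero _ ((hf z hz).trans h0)
  have hsub : Metric.sphere a (‖a - b‖ / 2) ⊆ Lᶜ ∪ Eᶜ := by
    rw [← compl_inter]
    intro z hz hz'
    rcases hLE hz' with rfl | rfl
    · simp only [mem_sphere_iff_norm, sub_self, norm_zero] at hz
      exact hr.ne hz
    · exact hzb _ hz (sub_self _)
  refine one_ne_zero (eq_zero_of_hasLog_sphere hr (n := 1)
    (((h1.mono hsub).mul h2).congr fun z hz => ?_))
  rw [zpow_one, div_mul_cancel₀ _ (hzb z hz)]

/-! ### Walks and the sets they trace -/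

theorem SimpleGraph.Walk.exists_eq_append_cons {V : Type*} {G : SimpleGraph V} {u v : V}
    (p : G.Walk u v) {e : Sym2 V} (he : e ∈ p.edges) :
    ∃ (x y : V) (h : G.Adj x y) (p₁ : G.Walk u x) (p₂ : G.Walk y v),
      e = s(x, y) ∧ p = p₁.append (.cons h p₂) := by
  induction p with
  | nil => simp at he
  | @cons u w v h p ih =>
    rw [SimpleGraph.Walk.edges_cons, List.mem_cons] at he
    rcases he with rfl | he
    · exact ⟨u, w, h, .nil, p, rfl, rfl⟩
    · obtain ⟨x, y, h', p₁, p₂, rfl, rfl⟩ := ih he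
      exact ⟨x, y, h', .cons h p₁, p₂, rfl, rfl⟩

/-- Deleting an edge from a cycle leaves a path. -/
theorem SimpleGraph.Walk.IsCycle.exists_isPath {V : Type*} {G : SimpleGraph V} {u : V}
    {c : G.Walk u u} (hc : c.IsCycle) {e : Sym2 V} (he : e ∈ c.edges) :
    ∃ (x y : V) (_ : G.Adj x y) (p : G.Walk y x), e = s(x, y) ∧ p.IsPath ∧ e ∉ p.edges ∧
      ∀ e', e' ∈ c.edges ↔ e' = e ∨ e' ∈ p.edges := by
  obtain ⟨x, y, h, p₁, p₂, rfl, rfl⟩ := c.exists_eq_append_cons he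
  have h1 := hc.isTrail.edges_nodup
  have h2 := hc.support_nodup
  rw [SimpleGraph.Walk.edges_append, SimpleGraph.Walk.edges_cons] at h1
  rw [SimpleGraph.Walk.support_append, SimpleGraph.Walk.support_cons, List.tail_cons,
    List.tail_append_of_ne_nil p₁.support_ne_nil] at h2
  refine ⟨x, y, h, p₂.append p₁, rfl, ?_, ?_, ?_⟩
  · rw [SimpleGraph.Walk.isPath_def, SimpleGraph.Walk.support_append]
    exact List.nodup_append_comm.mp h2
  · rw [List.nodup_append_comm, List.cons_append, List.nodup_cons] at h1
    rw [SimpleGraph.Walk.edges_append]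
    exact h1.1
  · intro e'
    simp only [SimpleGraph.Walk.edges_append, SimpleGraph.Walk.edges_cons, List.mem_append,
      List.mem_cons]
    tauto

namespace PlaneDrawing

variable {V : Type*} {G : SimpleGraph V} (D : PlaneDrawing G)

theorem exists_param {u v : V} (h : G.Adj u v) :
    ∃ γ : unitInterval → ℂ, Continuous γ ∧ Function.Injective γ ∧ γ 0 = D.pos u ∧
      γ 1 = D.pos v ∧ range γ = D.arc s(u, v) := by
  obtain ⟨γ, hγ, hr⟩ := D.arc_isArc u v h
  exact ⟨γ, γ.continuous, hγ, γ.source, γ.target, hr⟩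

theorem isCompact_arc {e : Sym2 V} (he : e ∈ G.edgeSet) : IsCompact (D.arc e) := by
  induction e with | _ u v
  obtain ⟨γ, hγ, -, -, -, hr⟩ := D.exists_param he
  exact hr ▸ isCompact_range hγ

theorem pos_mem_arc {e : Sym2 V} (he : e ∈ G.edgeSet) {w : V} (hw : w ∈ e) :
    D.pos w ∈ D.arc e := by
  induction e with | _ u v
  obtain ⟨γ, -, -, h0, h1, hr⟩ := D.exists_param he
  rw [← hr]
  rcases Sym2.mem_iff.mp hw with rfl | rfl
  · exact ⟨0, h0⟩
  · exact ⟨1, h1⟩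

/-- A common point of two edges is a common end. -/
theorem exists_pos_of_mem_arc {e e' : Sym2 V} (he : e ∈ G.edgeSet) (he' : e' ∈ G.edgeSet)
    (hne : e ≠ e') {z : ℂ} (hz : z ∈ D.arc e) (hz' : z ∈ D.arc e') :
    ∃ w, D.pos w = z ∧ w ∈ e ∧ w ∈ e' := by
  obtain ⟨w, rfl⟩ := D.arc_inter_subset e he e' he' hne ⟨hz, hz'⟩
  exact ⟨w, rfl, D.mem_of_pos_mem_arc e he w hz, D.mem_of_pos_mem_arc e' he' w hz'⟩

/-- The points of the plane covered by a walk. -/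
def trace {u v : V} (p : G.Walk u v) : Set ℂ :=
  {D.pos u} ∪ ⋃ e ∈ p.edges, D.arc e

theorem trace_cons {u v w : V} (h : G.Adj u v) (p : G.Walk v w) :
    D.trace (.cons h p) = D.trace p ∪ D.arc s(u, v) := by
  have hu := D.pos_mem_arc h (Sym2.mem_mk_left u v)
  have hv := D.pos_mem_arc h (Sym2.mem_mk_right u v)
  ext z
  simp only [trace, SimpleGraph.Walk.edges_cons, List.mem_cons, mem_union, mem_singleton_iff,
    mem_iUnion, exists_prop, exists_eq_or_imp]
  constructor
  · rintro (rfl | h | h)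
    · exact Or.inr hu
    · exact Or.inr h
    · exact Or.inl (Or.inr h)
  · rintro ((rfl | h) | h)
    · exact Or.inr (Or.inl hv)
    · exact Or.inr (Or.inr h)
    · exact Or.inr (Or.inl h)

theorem trace_nil {u : V} : D.trace (.nil : G.Walk u u) = {D.pos u} := by
  simp [trace]

theorem isCompact_trace {u v : V} (p : G.Walk u v) : IsCompact (D.trace p) := by
  refine isCompact_singleton.union ?_
  exact (List.finite_toSet p.edges).isCompact_biUnion
    fun e he => D.isCompact_arc (p.edges_subset_edgeSet he)

theorem pos_mem_trace_of_mem_support {u v w : V} (p : G.Walk u v) (hw : w ∈ p.support) :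
    D.pos w ∈ D.trace p := by
  induction p with
  | nil =>
    rw [SimpleGraph.Walk.support_nil, List.mem_singleton] at hw
    exact Or.inl (congrArg D.pos hw)
  | cons h p ih =>
    rw [trace_cons]
    rw [SimpleGraph.Walk.support_cons, List.mem_cons] at hw
    rcases hw with rfl | hw
    · exact Or.inr (D.pos_mem_arc h (Sym2.mem_mk_left _ _))
    · exact Or.inl (ih hw)

theorem exists_pos_of_mem_trace_of_mem_arc {u v : V} (p : G.Walk u v) {e : Sym2 V}
    (he : e ∈ G.edgeSet) (hep : e ∉ p.edges) {z : ℂ} (hz : z ∈ D.trace p) (hz' : z ∈ D.arc e) :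
    ∃ w, D.pos w = z ∧ w ∈ p.support ∧ w ∈ e := by
  rcases hz with rfl | hz
  · exact ⟨u, rfl, p.start_mem_support, D.mem_of_pos_mem_arc e he u hz'⟩
  · simp only [mem_iUnion, exists_prop] at hz
    obtain ⟨e', he', hz⟩ := hz
    obtain ⟨w, hw, hwe, hwe'⟩ := D.exists_pos_of_mem_arc he (p.edges_subset_edgeSet he')
      (fun h => hep (h ▸ he')) hz' hz
    exact ⟨w, hw, p.mem_support_of_mem_edges he' hwe', hwe⟩

/-- The first edge of a path meets the rest only at its second vertex, so logarithms glue edge by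
edge: a path does not separate the plane. -/
theorem hasLog_trace {u v : V} {p : G.Walk u v} (hp : p.IsPath) {a b : ℂ} (ha : a ∉ D.trace p)
    (hb : b ∉ D.trace p) : HasLog (D.trace p) fun z => (z - a) / (z - b) := by
  induction p with
  | nil =>
    rw [trace_nil] at *
    refine ⟨fun z => Complex.log ((z - a) / (z - b)), continuousOn_singleton _ _, fun z hz => ?_⟩
    rw [mem_singleton_iff] at hz ha hb
    subst hz
    exact Complex.exp_log (div_ne_zero (sub_ne_zero.mpr (Ne.symm ha)) (sub_ne_zero.mpr (Ne.symm hb)))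
  | @cons u v w h p ih =>
    rw [trace_cons] at *
    rw [SimpleGraph.Walk.cons_isPath_iff] at hp
    obtain ⟨γ, hγ, hinj, h0, h1, hr⟩ := D.exists_param h
    refine HasLog.union_of_isClosed (ih hp.1 (fun h => ha (Or.inl h)) (fun h => hb (Or.inl h))) ?_
      (D.isCompact_trace p).isClosed (D.isCompact_arc h).isClosed ?_
    · rw [← hr] at ha hb ⊢
      exact hasLog_sub_div_sub_of_injective hγ hinj (fun h => ha (Or.inr h)) (fun h => hb (Or.inr h))
    · apply Set.Subsingleton.isPreconnected
      refine subsingleton_of_subset_singleton (a := D.pos v) ?_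
      rintro z ⟨hz, hz'⟩
      obtain ⟨x, rfl, hx, hx'⟩ := D.exists_pos_of_mem_trace_of_mem_arc p h
        (fun he => hp.2 (p.fst_mem_support_of_mem_edges he)) hz hz'
      rcases Sym2.mem_iff.mp hx' with rfl | rfl
      · exact absurd hx hp.2
      · rfl

/-- The quotients for the single edges telescope. -/
theorem hasLog_compl_trace {u v : V} (p : G.Walk u v) :
    HasLog (D.trace p)ᶜ fun z => (z - D.pos u) / (z - D.pos v) := by
  induction p with
  | @nil u =>
    rw [trace_nil]
    refine ⟨fun _ => 0, continuousOn_const, fun z hz => ?_⟩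
    exact Complex.exp_zero.trans (div_self (sub_ne_zero.mpr hz)).symm
  | @cons u v w h p ih =>
    rw [trace_cons]
    obtain ⟨γ, hγ, -, h0, h1, hr⟩ := D.exists_param h
    have := hasLog_compl_range hγ
    rw [h0, h1, hr] at this
    refine ((this.mono (compl_subset_compl.mpr subset_union_right)).mul
      (ih.mono (compl_subset_compl.mpr subset_union_left))).congr fun z hz => ?_
    refine div_mul_div_cancel₀ fun h0 => hz (Or.inl ?_)
    rw [sub_eq_zero.mp h0]
    exact D.pos_mem_trace_of_mem_support p p.start_mem_support

/-- The part of the drawing which remains when the edge `e` is deleted. -/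
def supportDelete (e : Sym2 V) : Set ℂ :=
  range D.pos ∪ ⋃ e' ∈ G.edgeSet \ {e}, D.arc e'

theorem isCompact_supportDelete [Finite V] (e : Sym2 V) : IsCompact (D.supportDelete e) := by
  have : Finite (Sym2 V) := Quot.finite _
  exact (finite_range D.pos).isCompact.union ((toFinite _).isCompact_biUnion
    fun e' he' => D.isCompact_arc he'.1)

theorem support_eq {e : Sym2 V} (he : e ∈ G.edgeSet) :
    D.support = D.supportDelete e ∪ D.arc e := by
  have : G.edgeSet = insert e (G.edgeSet \ {e}) := by rw [insert_sdiff_singleton, insert_eq_of_mem he]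
  rw [support, this, biUnion_insert, supportDelete, union_comm (D.arc e), union_assoc]

/-- The form in which the arc lemmas need that an edge meets the rest of the drawing only in its
ends. -/
theorem param_mem_supportDelete_iff {x y : V} (h : G.Adj x y) {γ : unitInterval → ℂ}
    (hinj : Function.Injective γ) (h0 : γ 0 = D.pos x) (h1 : γ 1 = D.pos y)
    (hr : range γ = D.arc s(x, y)) (t : unitInterval) :
    γ t ∈ D.supportDelete s(x, y) ↔ t = 0 ∨ t = 1 := by
  have ht : γ t ∈ D.arc s(x, y) := hr ▸ mem_range_self t
  constructor
  · intro hmem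
    have : ∃ w, D.pos w = γ t := by
      rcases hmem with hw | hw
      · exact hw
      · simp only [mem_iUnion, exists_prop] at hw
        obtain ⟨e', he', hz⟩ := hw
        exact D.arc_inter_subset _ h _ he'.1 (fun h => he'.2 h.symm) ⟨ht, hz⟩
    obtain ⟨w, hw⟩ := this
    rcases Sym2.mem_iff.mp (D.mem_of_pos_mem_arc _ h w (hw ▸ ht)) with rfl | rfl
    · exact Or.inl (hinj (hw.symm.trans h0.symm))
    · exact Or.inr (hinj (hw.symm.trans h1.symm))
  · rintro (rfl | rfl)
    · exact Or.inl ⟨x, h0.symm⟩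
    · exact Or.inl ⟨y, h1.symm⟩

theorem trace_subset_supportDelete {u v : V} (p : G.Walk u v) {e : Sym2 V} (he : e ∉ p.edges) :
    D.trace p ⊆ D.supportDelete e := by
  refine union_subset_union (singleton_subset_iff.mpr (mem_range_self u)) ?_
  exact biUnion_subset_biUnion_left fun e' he' =>
    ⟨p.edges_subset_edgeSet he', fun h => he (mem_singleton_iff.mp h ▸ he')⟩

theorem trace_subset_support {u v : V} (p : G.Walk u v) : D.trace p ⊆ D.support :=
  union_subset_union (singleton_subset_iff.mpr (mem_range_self u))
    (biUnion_subset_biUnion_left fun _ he => p.edges_subset_edgeSet he)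

/-! ### Inside and outside of a cycle; the two faces at an edge -/

/-- The points inside a closed walk: those in a bounded component of its complement. -/
def inside {v : V} (c : G.Walk v v) : Set ℂ :=
  {z | z ∉ D.trace c ∧ Bornology.IsBounded (connectedComponentIn (D.trace c)ᶜ z)}

theorem mem_inside_iff_of_mem_connectedComponentIn {v : V} {c : G.Walk v v} {p q : ℂ}
    (h : q ∈ connectedComponentIn (D.trace c)ᶜ p) : p ∈ D.inside c ↔ q ∈ D.inside c := by
  have hp : p ∉ D.trace c := connectedComponentIn_nonempty_iff.mp ⟨q, h⟩
  have hq : q ∉ D.trace c := connectedComponentIn_subset _ _ h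
  simp only [inside, mem_ofPred_eq, hp, hq, not_false_eq_true, true_and, connectedComponentIn_eq h]

theorem mem_inside_iff_of_mem_face {v : V} {c : G.Walk v v} {p q : ℂ}
    (h : q ∈ connectedComponentIn D.supportᶜ p) : p ∈ D.inside c ↔ q ∈ D.inside c :=
  D.mem_inside_iff_of_mem_connectedComponentIn
    (connectedComponentIn_mono p (compl_subset_compl.mpr (D.trace_subset_support c)) h)

/-- This puts every face inside a cycle within reach of the signature. -/
theorem isBounded_of_mem_inside {v : V} {c : G.Walk v v} {p : ℂ} (h : p ∈ D.inside c) :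
    Bornology.IsBounded (connectedComponentIn D.supportᶜ p) :=
  h.2.subset (connectedComponentIn_mono p (compl_subset_compl.mpr (D.trace_subset_support c)))

/-- The Jordan curve theorem for cycles: points inside and outside a cycle which are both near to a
given edge of the cycle. -/
theorem exists_inside_outside {u x y : V} {c : G.Walk u u} (h : G.Adj x y) {p : G.Walk y x}
    (hp : p.IsPath) (hep : s(x, y) ∉ p.edges)
    (hcp : ∀ e', e' ∈ c.edges ↔ e' = s(x, y) ∨ e' ∈ p.edges) :
    ∃ a b, a ∈ D.inside c ∧ b ∉ D.trace c ∧ b ∉ D.inside c ∧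
      D.arc s(x, y) ⊆ closure (connectedComponentIn (D.trace c)ᶜ a) ∧
      D.arc s(x, y) ⊆ closure (connectedComponentIn (D.trace c)ᶜ b) := by
  obtain ⟨γ, hγ, hinj, h0, h1, hr⟩ := D.exists_param h
  have hJ : D.trace c = D.trace p ∪ range γ := by
    have hc0 : c.edges ≠ [] := List.ne_nil_of_mem ((hcp _).mpr (Or.inl rfl))
    have hu : ∃ e ∈ c.edges, u ∈ e := by
      cases c with
      | nil => simp at hc0
      | @cons _ w _ h' c' => exact ⟨s(u, w), by simp, Sym2.mem_mk_left _ _⟩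
    obtain ⟨e, hec, hue⟩ := hu
    rw [hr]
    ext z
    simp only [trace, mem_union, mem_singleton_iff, mem_iUnion, exists_prop, hcp, or_and_right,
      exists_or, exists_eq_left]
    constructor
    · rintro (rfl | hz | hz)
      · rcases (hcp e).mp hec with rfl | hep'
        · exact Or.inr (D.pos_mem_arc h hue)
        · exact Or.inl (Or.inr ⟨e, hep', D.pos_mem_arc (c.edges_subset_edgeSet hec) hue⟩)
      · exact Or.inr hz
      · exact Or.inl (Or.inr hz)
    · rintro ((rfl | hz) | hz)
      · exact Or.inr (Or.inl (D.pos_mem_arc h (Sym2.mem_mk_right _ _)))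
      · exact Or.inr (Or.inr hz)
      · exact Or.inr (Or.inl hz)
  have hM := D.isCompact_trace p
  have hE : IsCompact (range γ) := isCompact_range hγ
  have hγM : ∀ t, γ t ∈ D.trace p → t = 0 ∨ t = 1 := fun t ht =>
    (D.param_mem_supportDelete_iff h hinj h0 h1 hr t).mp (D.trace_subset_supportDelete p hep ht)
  have hxy : D.pos y ≠ D.pos x := fun heq => h.ne (D.pos_injective heq).symm
  have hnot : ¬ IsPreconnected (D.trace p ∪ range γ)ᶜ := by
    -- The path runs from `y` to `x` but `γ` from `x` to `y`, hence the inverse.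
    refine not_isPreconnected_compl_union hM.isClosed hE.isClosed hxy ?_
      (D.hasLog_compl_trace p) ((hasLog_compl_range hγ).inv.congr fun z _ => ?_)
    · rintro _ ⟨hz, t, rfl⟩
      rcases hγM t hz with rfl | rfl
      · exact Or.inr h0
      · exact Or.inl h1
    · rw [inv_div, h0, h1]
  have hsame : ∀ a ∉ D.trace p ∪ range γ, ∀ b ∉ D.trace p ∪ range γ,
      b ∈ connectedComponentIn (D.trace p)ᶜ a := fun a ha b hb =>
    mem_connectedComponentIn_of_hasLog hM (fun h => ha (Or.inl h)) (fun h => hb (Or.inl h))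
      (D.hasLog_trace hp (fun h => ha (Or.inl h)) (fun h => hb (Or.inl h)))
  have hK := hM.union hE
  obtain ⟨b, hb, hbu, -⟩ := exists_unbounded_connectedComponentIn hK
  -- Only one component is unbounded, so if none were bounded the complement would be connected.
  have ha : ∃ a ∉ D.trace p ∪ range γ,
      Bornology.IsBounded (connectedComponentIn (D.trace p ∪ range γ)ᶜ a) := by
    by_contra! hcon
    refine hnot (isPreconnected_of_forall_pair fun p hp q hq => ?_)
    refine ⟨connectedComponentIn _ p, connectedComponentIn_subset _ _,
      mem_connectedComponentIn hp, ?_, isPreconnected_connectedComponentIn⟩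
    by_contra hpq
    exact (isBounded_or_isBounded_of_notMem hK hpq).elim (hcon p hp) (hcon q hq)
  obtain ⟨a, ha, hab⟩ := ha
  have hsep : b ∉ connectedComponentIn (D.trace p ∪ range γ)ᶜ a := fun hmem =>
    hbu (connectedComponentIn_eq hmem ▸ hab)
  rw [inside, hJ, ← hr]
  refine ⟨a, b, ⟨ha, hab⟩, hb, fun h => hbu h.2, ?_, ?_⟩
  · exact (range_subset_frontier hM hγ hinj hγM ha hb (hsame a ha b hb) hsep).trans
      frontier_subset_closure
  · exact (range_subset_frontier hM hγ hinj hγM hb ha (hsame b hb a ha)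
      fun h => hsep (mem_connectedComponentIn_comm h)).trans frontier_subset_closure

/-- An edge of a cycle belongs to exactly two faces, one inside and one outside the cycle. They are
on the same side of every closed walk which does not contain the edge. -/
theorem exists_faces_of_mem_edges [Finite V] {u : V} {c : G.Walk u u} (hc : c.IsCycle)
    {e : Sym2 V} (he : e ∈ c.edges) :
    ∃ a b, (∀ F, D.IsFace F ∧ e ∈ D.faceEdges F ↔
        F = connectedComponentIn D.supportᶜ a ∨ F = connectedComponentIn D.supportᶜ b) ∧
      a ∈ D.inside c ∧ b ∉ D.inside c ∧
      ∀ (v : V) (c' : G.Walk v v), e ∉ c'.edges → (a ∈ D.inside c' ↔ b ∈ D.inside c') := by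
  obtain ⟨x, y, h, p, rfl, hp, hep, hcp⟩ := hc.exists_isPath he
  obtain ⟨a, b, ha, hb, hb', haE, hbE⟩ := D.exists_inside_outside h hp hep hcp
  obtain ⟨γ, hγ, hinj, h0, h1, hr⟩ := D.exists_param h
  have hγL := D.param_mem_supportDelete_iff h hinj h0 h1 hr
  have hL := D.isCompact_supportDelete s(x, y)
  have hK : D.support = D.supportDelete s(x, y) ∪ range γ := by rw [hr]; exact D.support_eq h
  have hEJ : range γ ⊆ D.trace c := by
    rw [hr]
    exact (subset_biUnion_of_mem (u := fun e => D.arc e) he).trans subset_union_right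
  obtain ⟨t, ht⟩ : ∃ t : unitInterval, ¬ (t = 0 ∨ t = 1) := by
    obtain ⟨t, ht⟩ := exists_between (zero_lt_one (α := unitInterval))
    exact ⟨t, not_or.mpr ⟨ht.1.ne', ht.2.ne⟩⟩
  have htE : γ t ∈ D.arc s(x, y) := hr ▸ mem_range_self t
  -- In a ball about an interior point of the edge, the drawing consists of that edge only. Every
  -- face with this edge on its frontier meets the ball, and no closed walk avoiding the edge
  -- separates points of the ball.
  obtain ⟨ε, hε, hN⟩ := Metric.isOpen_iff.mp hL.isClosed.isOpen_compl (γ t) (mt (hγL t).mp ht)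
  have hpre : IsPreconnected (Metric.ball (γ t) ε) := Metric.isPreconnected_ball
  have hnear : ∀ {F : Set ℂ}, D.arc s(x, y) ⊆ closure F → ∃ z ∈ F, z ∈ Metric.ball (γ t) ε := by
    intro F hF
    obtain ⟨z, hz, hz'⟩ := mem_closure_iff.mp (hF htE) _ Metric.isOpen_ball
      (Metric.mem_ball_self hε)
    exact ⟨z, hz', hz⟩
  have hnotin : ∀ {w z : ℂ}, z ∈ connectedComponentIn (D.trace c)ᶜ w → z ∈ Metric.ball (γ t) ε →
      z ∉ D.supportDelete s(x, y) ∪ range γ := fun hz hz' hzK =>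
    hzK.elim (hN hz') fun h => connectedComponentIn_subset _ _ hz (hEJ h)
  obtain ⟨a', ha', haN⟩ := hnear haE
  obtain ⟨b', hb'', hbN⟩ := hnear hbE
  have haK := hnotin ha' haN
  have hbK := hnotin hb'' hbN
  have hain : a' ∈ D.inside c := (D.mem_inside_iff_of_mem_connectedComponentIn ha').mp ha
  have hbin : b' ∉ D.inside c := fun h =>
    hb' ((D.mem_inside_iff_of_mem_connectedComponentIn hb'').mpr h)
  have hball : ∀ {w z : ℂ} {S : Set ℂ}, S ⊆ D.supportDelete s(x, y) → w ∈ Metric.ball (γ t) ε →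
      z ∈ Metric.ball (γ t) ε → z ∈ connectedComponentIn Sᶜ w := fun hS hw hz =>
    hpre.subset_connectedComponentIn hw (hN.trans (compl_subset_compl.mpr hS)) hz
  have hsep : b' ∉ connectedComponentIn D.supportᶜ a' := fun h =>
    hbin ((D.mem_inside_iff_of_mem_face h).mp hain)
  refine ⟨a', b', fun F => ?_, hain, hbin, fun v c' hc' =>
    D.mem_inside_iff_of_mem_connectedComponentIn
      (hball (D.trace_subset_supportDelete c' hc') haN hbN)⟩
  rw [hK] at hsep
  constructor
  · rintro ⟨⟨w, hw, rfl⟩, -, hF⟩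
    obtain ⟨z, hz, hzN⟩ := hnear (hF.trans frontier_subset_closure)
    have hzK := connectedComponentIn_subset _ _ hz
    rw [hK] at hzK
    rw [connectedComponentIn_eq hz, hK]
    rcases mem_connectedComponentIn_or hL hγ hinj hγL haK hbK hzK (hball subset_rfl haN hzN)
      (hball subset_rfl hbN hzN) hsep with h | h
    · exact Or.inl (connectedComponentIn_eq h).symm
    · exact Or.inr (connectedComponentIn_eq h).symm
  · rintro (rfl | rfl)
    · refine ⟨⟨a', hK ▸ haK, rfl⟩, h, ?_⟩
      rw [hK, ← hr]
      exact range_subset_frontier hL hγ hinj (fun t => (hγL t).mp) haK hbK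
        (hball subset_rfl haN hbN) hsep
    · refine ⟨⟨b', hK ▸ hbK, rfl⟩, h, ?_⟩
      rw [hK, ← hr]
      exact range_subset_frontier hL hγ hinj (fun t => (hγL t).mp) hbK haK
        (hball subset_rfl hbN haN) fun h => hsep (mem_connectedComponentIn_comm h)

end PlaneDrawing

/-! ### Double counting of edges and faces -/

/-- Exchange the summation: an edge contributes one for its single face in `S` if it has one, and
zero otherwise. -/
theorem sum_card_incident_eq {α Φ : Type*} {A : Finset α} {T : Finset Φ} {inc : α → Φ → Prop}
    {p q : α → Φ} (hinc : ∀ e ∈ A, ∀ H, inc e H ↔ H = p e ∨ H = q e)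
    (hp : ∀ e ∈ A, p e ∈ T) (hq : ∀ e ∈ A, q e ∈ T) {S : Φ → Prop} {R : α → Prop}
    [DecidablePred R] (hS : ∀ e ∈ A, ¬ (S (p e) ∧ S (q e))) (hR : ∀ e ∈ A, R e ↔ S (p e) ∨ S (q e)) :
    open Classical in ∑ H ∈ T with S H, (A.filter (inc · H)).card = (A.filter R).card := by
  classical
  have h1 := Finset.sum_card_bipartiteAbove_eq_sum_card_bipartiteBelow
    (s := A) (t := T.filter S) inc
  simp only [Finset.bipartiteAbove, Finset.bipartiteBelow] at h1
  rw [← h1, Finset.card_filter]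
  refine Finset.sum_congr rfl fun e he => ?_
  split_ifs with hRe
  · rw [Finset.card_eq_one]
    rcases (hR e he).mp hRe with h | h
    · refine ⟨p e, ?_⟩
      ext H
      simp only [Finset.mem_filter, hinc e he, Finset.mem_singleton]
      constructor
      · rintro ⟨⟨-, hH⟩, rfl | rfl⟩
        · rfl
        · exact absurd ⟨h, hH⟩ (hS e he)
      · rintro rfl
        exact ⟨⟨hp e he, h⟩, Or.inl rfl⟩
    · refine ⟨q e, ?_⟩
      ext H
      simp only [Finset.mem_filter, hinc e he, Finset.mem_singleton]
      constructor
      · rintro ⟨⟨-, hH⟩, rfl | rfl⟩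
        · exact absurd ⟨hH, h⟩ (hS e he)
        · rfl
      · rintro rfl
        exact ⟨⟨hq e he, h⟩, Or.inr rfl⟩
  · rw [Finset.card_eq_zero, Finset.filter_eq_empty_iff]
    intro H hH hi
    rw [Finset.mem_filter] at hH
    refine hRe ((hR e he).mpr ?_)
    rcases (hinc e he H).mp hi with rfl | rfl
    · exact Or.inl hH.2
    · exact Or.inr hH.2

/-- The counting argument. The edges in `A` separate the inside of the first curve from its outside,
those in `B` the inside of the second from its outside. -/
theorem four_dvd_card_add_card {α Φ : Type*} {A B : Finset α} {inc : α → Φ → Prop}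
    {i₁ i₂ : Φ → Prop}
    (hA : ∀ e ∈ A, ∃ p q, (∀ H, inc e H ↔ H = p ∨ H = q) ∧ i₁ p ∧ ¬ i₁ q ∧ (i₂ p ↔ i₂ q))
    (hB : ∀ e ∈ B, ∃ p q, (∀ H, inc e H ↔ H = p ∨ H = q) ∧ i₂ p ∧ ¬ i₂ q ∧ (i₁ p ↔ i₁ q))
    (hsig : open Classical in ∀ H, i₁ H ∨ i₂ H →
      (A.filter (inc · H)).card = (B.filter (inc · H)).card) :
    4 ∣ A.card + B.card := by
  classical
  rcases isEmpty_or_nonempty Φ with hΦ | hΦ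
  · have hA0 : A = ∅ := Finset.eq_empty_of_forall_notMem fun e he => (hΦ.elim (hA e he).choose)
    have hB0 : B = ∅ := Finset.eq_empty_of_forall_notMem fun e he => (hΦ.elim (hB e he).choose)
    simp [hA0, hB0]
  choose! p q hpq h1 h2 h3 using hA
  choose! r s hrs h4 h5 h6 using hB
  -- `Φ` may be infinite; only faces at edges of `A` or `B` contribute to the sums.
  let T : Finset Φ := A.image p ∪ A.image q ∪ B.image r ∪ B.image s
  have hp : ∀ e ∈ A, p e ∈ T := fun e he => by
    simp only [T, Finset.mem_union, Finset.mem_image]; exact Or.inl (Or.inl (Or.inl ⟨e, he, rfl⟩))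
  have hq : ∀ e ∈ A, q e ∈ T := fun e he => by
    simp only [T, Finset.mem_union, Finset.mem_image]; exact Or.inl (Or.inl (Or.inr ⟨e, he, rfl⟩))
  have hr : ∀ e ∈ B, r e ∈ T := fun e he => by
    simp only [T, Finset.mem_union, Finset.mem_image]; exact Or.inl (Or.inr ⟨e, he, rfl⟩)
  have hs : ∀ e ∈ B, s e ∈ T := fun e he => by
    simp only [T, Finset.mem_union, Finset.mem_image]; exact Or.inr ⟨e, he, rfl⟩
  have key : ∀ (S : Φ → Prop) (R R' : α → Prop) [DecidablePred R] [DecidablePred R'],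
      (∀ H, S H → i₁ H ∨ i₂ H) →
      (∀ e ∈ A, ¬ (S (p e) ∧ S (q e))) → (∀ e ∈ A, R e ↔ S (p e) ∨ S (q e)) →
      (∀ e ∈ B, ¬ (S (r e) ∧ S (s e))) → (∀ e ∈ B, R' e ↔ S (r e) ∨ S (s e)) →
      (A.filter R).card = (B.filter R').card := by
    intro S R R' _ _ hS hA1 hA2 hB1 hB2
    rw [← sum_card_incident_eq hpq hp hq hA1 hA2, ← sum_card_incident_eq hrs hr hs hB1 hB2]
    exact Finset.sum_congr rfl fun H hH => hsig H (hS H (Finset.mem_filter.mp hH).2)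
  -- The regions inside the first curve only, inside the second only, and inside both.
  have e1 := key (fun H => i₁ H ∧ ¬ i₂ H) (fun e => ¬ i₂ (p e)) (fun e => i₁ (r e))
    (fun H h => Or.inl h.1) (by grind) (by grind) (by grind) (by grind)
  have e2 := key (fun H => i₂ H ∧ ¬ i₁ H) (fun e => i₂ (p e)) (fun e => ¬ i₁ (r e))
    (fun H h => Or.inr h.1) (by grind) (by grind) (by grind) (by grind)
  have e3 := key (fun H => i₁ H ∧ i₂ H) (fun e => i₂ (p e)) (fun e => i₁ (r e))
    (fun H h => Or.inl h.1) (by grind) (by grind) (by grind) (by grind)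
  have e4 := Finset.card_filter_add_card_filter_not (s := A) (fun e => i₂ (p e))
  have e5 := Finset.card_filter_add_card_filter_not (s := B) (fun e => i₁ (r e))
  omega

/-- Translates sides of points into sides of faces: a face lies entirely on one side of a closed
walk, so meeting the inside can be tested at any of its points. -/
theorem PlaneDrawing.exists_incident_faces {V : Type*} [Finite V] {G : SimpleGraph V}
    (D : PlaneDrawing G) {u v : V} {c₁ : G.Walk u u} (c₂ : G.Walk v v) (hc₁ : c₁.IsCycle)
    {e : Sym2 V} (he : e ∈ c₁.edges) (he' : e ∉ c₂.edges) :
    ∃ P Q, (∀ F, D.IsFace F ∧ e ∈ D.faceEdges F ↔ F = P ∨ F = Q) ∧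
      (P ∩ D.inside c₁).Nonempty ∧ ¬ (Q ∩ D.inside c₁).Nonempty ∧
      ((P ∩ D.inside c₂).Nonempty ↔ (Q ∩ D.inside c₂).Nonempty) := by
  obtain ⟨a, b, hF, ha, hb, h⟩ := D.exists_faces_of_mem_edges hc₁ he
  have key : ∀ {x : ℂ}, D.IsFace (connectedComponentIn D.supportᶜ x) → ∀ {w : V} (c : G.Walk w w),
      (connectedComponentIn D.supportᶜ x ∩ D.inside c).Nonempty ↔ x ∈ D.inside c := by
    rintro x ⟨y, hy, hxy⟩ w c
    have hx : x ∈ D.supportᶜ :=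
      connectedComponentIn_nonempty_iff.mp (hxy ▸ ⟨y, mem_connectedComponentIn hy⟩)
    exact ⟨fun ⟨z, hz, hz'⟩ => (D.mem_inside_iff_of_mem_face hz).mpr hz',
      fun hxc => ⟨x, mem_connectedComponentIn hx, hxc⟩⟩
  have haF := ((hF _).mpr (Or.inl rfl)).1
  have hbF := ((hF _).mpr (Or.inr rfl)).1
  refine ⟨_, _, hF, (key haF c₁).mpr ha, fun h => hb ((key hbF c₁).mp h), ?_⟩
  rw [key haF, key hbF]
  exact h v c₂ he'

/-- The edges common to both cycles cancel from the two signatures. -/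
theorem PlaneDrawing.card_filter_sdiff_eq {V : Type*} [DecidableEq V] {G : SimpleGraph V}
    (D : PlaneDrawing G) {u v : V} {c₁ : G.Walk u u} {c₂ : G.Walk v v}
    (hsig : D.signature c₁ = D.signature c₂) {F : Set ℂ} (hF : D.IsFace F)
    (hb : Bornology.IsBounded F) : open Classical in
    ((c₁.edges.toFinset \ c₂.edges.toFinset).filter fun e => D.IsFace F ∧ e ∈ D.faceEdges F).card =
    ((c₂.edges.toFinset \ c₁.edges.toFinset).filter
      fun e => D.IsFace F ∧ e ∈ D.faceEdges F).card := by
  classical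
  have h := congrFun hsig ⟨F, hF, hb⟩
  have hcoe : ∀ {w : V} (c : G.Walk w w), D.signature c ⟨F, hF, hb⟩ =
      (c.edges.toFinset.filter fun e => D.IsFace F ∧ e ∈ D.faceEdges F).card := by
    intro w c
    change (D.faceEdges F ∩ {e | e ∈ c.edges}).ncard = _
    rw [← Set.ncard_coe_finset]
    congr 1
    ext e
    simp [hF, and_comm]
  rw [hcoe, hcoe] at h
  convert! Finset.card_sdiff_comm h using 2 <;> grind

theorem theoremd4 {V : Type*} [Finite V] (G : SimpleGraph V) (hconn : G.Connected)
    (hbridge : ∀ e ∈ G.edgeSet, ¬ G.IsBridge e) (D : PlaneDrawing G)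
    {u v : V} (c₁ : G.Walk u u) (c₂ : G.Walk v v) (hc₁ : c₁.IsCycle) (hc₂ : c₂.IsCycle)
    (hsig : D.signature c₁ = D.signature c₂) :
    4 ∣ (c₁.edgeDifference c₂).ncard := by
  classical
  have hcoe : c₁.edgeDifference c₂ = ((c₁.edges.toFinset \ c₂.edges.toFinset ∪
      c₂.edges.toFinset \ c₁.edges.toFinset : Finset (Sym2 V)) : Set (Sym2 V)) := by
    ext e
    simp [SimpleGraph.Walk.edgeDifference, Set.mem_symmDiff]
  rw [hcoe, Set.ncard_coe_finset, Finset.card_union_of_disjoint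
    (Finset.disjoint_left.mpr (by simp only [Finset.mem_sdiff]; tauto))]
  refine four_dvd_card_add_card (inc := fun e F => D.IsFace F ∧ e ∈ D.faceEdges F)
    (i₁ := fun F => D.IsFace F ∧ (F ∩ D.inside c₁).Nonempty)
    (i₂ := fun F => D.IsFace F ∧ (F ∩ D.inside c₂).Nonempty) (fun e he => ?_) (fun e he => ?_) ?_
  · rw [Finset.mem_sdiff, List.mem_toFinset, List.mem_toFinset] at he
    obtain ⟨P, Q, h, h1, h2, h3⟩ := D.exists_incident_faces c₂ hc₁ he.1 he.2
    have hP := ((h P).mpr (Or.inl rfl)).1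
    have hQ := ((h Q).mpr (Or.inr rfl)).1
    exact ⟨P, Q, h, ⟨hP, h1⟩, fun h => h2 h.2, by simp only [hP, hQ, h3]⟩
  · rw [Finset.mem_sdiff, List.mem_toFinset, List.mem_toFinset] at he
    obtain ⟨P, Q, h, h1, h2, h3⟩ := D.exists_incident_faces c₁ hc₂ he.1 he.2
    have hP := ((h P).mpr (Or.inl rfl)).1
    have hQ := ((h Q).mpr (Or.inr rfl)).1
    exact ⟨P, Q, h, ⟨hP, h1⟩, fun h => h2 h.2, by simp only [hP, hQ, h3]⟩
  · intro F hF
    -- The signature sees bounded faces only; a face meeting the inside of a cycle is one.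
    have hbd : ∀ {w : V} {c : G.Walk w w}, D.IsFace F → (F ∩ D.inside c).Nonempty →
        Bornology.IsBounded F := by
      rintro w c ⟨x, -, rfl⟩ ⟨z, hz, hzc⟩
      rw [connectedComponentIn_eq hz]
      exact D.isBounded_of_mem_inside hzc
    rcases hF with hF | hF
    · convert! D.card_filter_sdiff_eq hsig hF.1 (hbd hF.1 hF.2)
    · convert! D.card_filter_sdiff_eq hsig hF.1 (hbd hF.1 hF.2)
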